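/- Let $q$ be a complex number with $0<|q|<1$ and let $\ell\ge 0$ be an integer. Write $(a)_n=\prod_{j=0}^{n-1}(1-aq^{j})$, $(a)_\infty=\prod_{j\ge 0}(1-aq^{j})$, $\binom{x}{2}=x(x-1)/2$ for $x\in\mathbb Z$, and ${n\brack k}=\frac{(q)_n}{(q)_k(q)_{n-k}}$ for integers $0\le k\le n$, with ${n\brack k}=0$ for integers $k<0$ or $k>n$. Then $$\sum_{n=0}^{\infty}\frac{q^{n(n+1)}}{(q)_{2n+1}}\sum_{m=-\infty}^{\infty}\sum_{k=0}^{\ell}(-1)^m q^{\binom{2m+2k-\ell+1}{2}+\binom{m+1}{2}}{\ell\brack k}\left({2n+1\brack n-2m-2k+\ell}-q^{2m+2k-\ell+1}{2n+1\brack n-2m-2k+\ell-1}\right)$$ $$=\frac{2}{(q)_\infty}\sum_{j=0}^{\infty}(-1)^j q^{3\binom{2j+\ell+1}{2}+\binom{j+1}{2}}\left(1-q^{6j+3\ell+3}\right)(q^{j+1})_\ell .$$ Here, for each $n$, only finitely many $m$ contribute a nonzero term to the inner sum, and the series over $n$ and over $j$ converge absolutely. -/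

import Mathlib

namespace QSeries

/-- The finite `q`-shifted factorial `(a; q)_n = ∏_{j=0}^{n-1} (1 - a q^j)`. -/
noncomputable def qPoch (a q : ℂ) (n : ℕ) : ℂ :=
  ∏ j ∈ Finset.range n, (1 - a * q ^ j)

/-- The infinite `q`-shifted factorial `(a; q)_∞ = ∏_{j ≥ 0} (1 - a q^j)`. -/
noncomputable def qPochInf (a q : ℂ) : ℂ :=
  ∏' j : ℕ, (1 - a * q ^ j)

/-- The product that defines `(a; q)_∞` converges for `|q| < 1`. -/
theorem multipliable_qPochInf (a q : ℂ) (hq : ‖q‖ < 1) :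
    Multipliable fun j : ℕ => 1 - a * q ^ j := by
  have h : Summable fun j : ℕ => ‖-(a * q ^ j)‖ := by
    simpa [norm_mul, norm_pow] using
      (summable_geometric_of_lt_one (norm_nonneg q) hq).mul_left ‖a‖
  simpa [sub_eq_add_neg] using multipliable_one_add_of_summable h

/-- The `q`-binomial coefficient `(q; q)_n / ((q; q)_k (q; q)_{n-k})`, with an integer lower
index; it is zero unless `0 ≤ k ≤ n`. -/
noncomputable def qBinom (q : ℂ) (n : ℕ) (k : ℤ) : ℂ :=
  if 0 ≤ k ∧ k ≤ (n : ℤ) then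
    qPoch q q n / (qPoch q q k.toNat * qPoch q q (n - k.toNat))
  else 0

/-- The binomial coefficient `x(x-1)/2` of an integer `x` over `2` (the division is exact). -/
def choose2 (x : ℤ) : ℤ := x * (x - 1) / 2

theorem two_mul_choose2 (x : ℤ) : 2 * choose2 x = x * (x - 1) := by
  have h : (2 : ℤ) ∣ x * (x - 1) := (Int.even_mul_pred_self x).two_dvd
  exact Int.mul_ediv_cancel' h

/-- The `(n, m)` term of the left side: the sum over `0 ≤ k ≤ ℓ`. -/
noncomputable def innerTerm (q : ℂ) (ℓ n : ℕ) (m : ℤ) : ℂ :=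
  ∑ k ∈ Finset.range (ℓ + 1),
    (-1 : ℂ) ^ m * q ^ (choose2 (2 * m + 2 * k - ℓ + 1) + choose2 (m + 1)) * qBinom q ℓ k *
      (qBinom q (2 * n + 1) (n - 2 * m - 2 * k + ℓ) -
        q ^ (2 * m + 2 * k - ℓ + 1) * qBinom q (2 * n + 1) (n - 2 * m - 2 * k + ℓ - 1))

/-- The `j`-th term of the series on the right side. -/
noncomputable def rightTerm (q : ℂ) (ℓ j : ℕ) : ℂ :=
  (-1 : ℂ) ^ j * q ^ (3 * (2 * j + ℓ + 1).choose 2 + (j + 1).choose 2) *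
    (1 - q ^ (6 * j + 3 * ℓ + 3)) * qPoch (q ^ (j + 1)) q ℓ

end QSeries

/-! Put r = 2m + 2k - ℓ and sum over n first. Cauchy's identity (`hasSum_durfeeTerm`) sums each
q-binomial against q^{n(n+1)}/(q)_{2n+1}, so each bracket contributes `baileySum q r` / (q)_∞
(`hasSum_baileyTerm`). A bound C‖q‖^n uniform in r, with the summable weight (-1)^m q^{m(m+1)/2},
justifies the interchange.

For fixed s = m + k the finite q-binomial theorem collapses the k-sum to a multiple of (q^{-s})_ℓ.
This vanishes for 0 ≤ s < ℓ; the indices s = j + ℓ and s = -(j+1) both give the j-th right-hand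
term, whence the factor 2. -/

open Filter Topology

namespace QSeries

/-! ### q-shifted factorials -/

lemma qPoch_succ (a q : ℂ) (n : ℕ) : qPoch a q (n + 1) = qPoch a q n * (1 - a * q ^ n) :=
  Finset.prod_range_succ _ _

lemma qPoch_self_succ (q : ℂ) (n : ℕ) : qPoch q q (n + 1) = qPoch q q n * (1 - q ^ (n + 1)) := by
  rw [qPoch_succ, pow_succ']

@[simp] lemma qPoch_zero (a q : ℂ) : qPoch a q 0 = 1 := Finset.prod_range_zero _

lemma one_sub_pow_succ_ne_zero {q : ℂ} (hq : ‖q‖ < 1) (n : ℕ) : 1 - q ^ (n + 1) ≠ 0 := by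
  intro h
  have h1 : ‖q ^ (n + 1)‖ = 1 := by rw [← sub_eq_zero.mp h, norm_one]
  rw [norm_pow] at h1
  exact (pow_lt_one₀ (norm_nonneg q) hq n.succ_ne_zero).ne h1

lemma qPoch_self_ne_zero {q : ℂ} (hq : ‖q‖ < 1) (n : ℕ) : qPoch q q n ≠ 0 := by
  refine Finset.prod_ne_zero_iff.mpr fun j _ => ?_
  rw [← pow_succ']
  exact one_sub_pow_succ_ne_zero hq j

lemma tendsto_qPoch {a q : ℂ} (hq : ‖q‖ < 1) :
    Tendsto (qPoch a q) atTop (𝓝 (qPochInf a q)) :=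
  (multipliable_qPochInf a q hq).hasProd.tendsto_prod_nat

lemma qPochInf_self_ne_zero {q : ℂ} (hq : ‖q‖ < 1) : qPochInf q q ≠ 0 := by
  have h := tprod_one_add_ne_zero_of_summable (f := fun j : ℕ => -(q * q ^ j)) (fun j => ?_) ?_
  · simpa [qPochInf, sub_eq_add_neg] using h
  · rw [← sub_eq_add_neg, ← pow_succ']
    exact one_sub_pow_succ_ne_zero hq j
  · simpa [norm_mul, norm_pow] using
      (summable_geometric_of_lt_one (norm_nonneg q) hq).mul_left ‖q‖

lemma tendsto_inv_qPoch_self {q : ℂ} (hq : ‖q‖ < 1) :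
    Tendsto (fun n => (qPoch q q n)⁻¹) atTop (𝓝 (qPochInf q q)⁻¹) :=
  (tendsto_qPoch hq).inv₀ (qPochInf_self_ne_zero hq)

lemma exists_norm_inv_qPoch_self_le {q : ℂ} (hq : ‖q‖ < 1) :
    ∃ B : ℝ, 0 ≤ B ∧ ∀ n, ‖(qPoch q q n)⁻¹‖ ≤ B := by
  obtain ⟨B, hB⟩ := (tendsto_inv_qPoch_self hq).norm.bddAbove_range
  have hB' : ∀ n, ‖(qPoch q q n)⁻¹‖ ≤ B := fun n => hB ⟨n, rfl⟩
  exact ⟨B, (norm_nonneg _).trans (hB' 0), hB'⟩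

/-! ### Cauchy's identity -/

/-- The general term of Cauchy's (Durfee rectangle) series. -/
noncomputable def durfeeTerm (q : ℂ) (c i : ℕ) : ℂ :=
  q ^ (i * i + i * c) * ((qPoch q q i)⁻¹ * (qPoch q q (i + c))⁻¹)

lemma norm_durfeeTerm_le {q : ℂ} (hq : ‖q‖ < 1) {B : ℝ} (hB0 : 0 ≤ B)
    (hB : ∀ n, ‖(qPoch q q n)⁻¹‖ ≤ B) (c i : ℕ) :
    ‖durfeeTerm q c i‖ ≤ B * B * ‖q‖ ^ i := by
  rw [durfeeTerm, norm_mul, norm_mul, norm_pow, mul_comm (B * B)]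
  have hi : i ≤ i * i + i * c := (Nat.le_mul_self i).trans (Nat.le_add_right _ _)
  exact mul_le_mul (pow_le_pow_of_le_one (norm_nonneg q) hq.le hi)
    (mul_le_mul (hB i) (hB (i + c)) (norm_nonneg _) hB0) (by positivity) (by positivity)

lemma summable_durfeeTerm {q : ℂ} (hq : ‖q‖ < 1) (c : ℕ) : Summable (durfeeTerm q c) := by
  obtain ⟨B, hB0, hB⟩ := exists_norm_inv_qPoch_self_le hq
  exact .of_norm_bounded ((summable_geometric_of_lt_one (norm_nonneg q) hq).mul_left (B * B))
    (norm_durfeeTerm_le hq hB0 hB c)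

lemma durfeeTerm_zero_sub {q : ℂ} (hq : ‖q‖ < 1) (c : ℕ) :
    durfeeTerm q c 0 - durfeeTerm q (c + 1) 0 = -(q ^ (c + 1) * durfeeTerm q (c + 1) 0) := by
  have h1 := one_sub_pow_succ_ne_zero hq c
  have h2 := qPoch_self_ne_zero hq c
  simp only [durfeeTerm, zero_add, qPoch_self_succ, qPoch_zero]
  field_simp
  ring

/-- Since (i+1)² + (i+1)c = i² + i(c+2) + (c+1), all terms share a power of q, leaving a polynomial
identity. -/
lemma durfeeTerm_succ_sub {q : ℂ} (hq : ‖q‖ < 1) (c i : ℕ) :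
    durfeeTerm q c (i + 1) - durfeeTerm q (c + 1) (i + 1) =
      q ^ (c + 1) * durfeeTerm q (c + 2) i - q ^ (c + 1) * durfeeTerm q (c + 1) (i + 1) := by
  have h1 := one_sub_pow_succ_ne_zero hq i
  have h2 := qPoch_self_ne_zero hq i
  have h3 := qPoch_self_ne_zero hq (i + c + 1)
  have h4 := one_sub_pow_succ_ne_zero hq (i + c + 1)
  simp only [durfeeTerm, show i + 1 + c = i + c + 1 by ring,
    show i + 1 + (c + 1) = i + c + 1 + 1 by ring, show i + (c + 2) = i + c + 1 + 1 by ring,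
    qPoch_self_succ q (i + c + 1), qPoch_self_succ q i]
  field_simp
  ring

lemma tsum_durfeeTerm_sub {q : ℂ} (hq : ‖q‖ < 1) (c : ℕ) :
    (∑' i, durfeeTerm q c i) - ∑' i, durfeeTerm q (c + 1) i =
      -q ^ (c + 1) * ((∑' i, durfeeTerm q (c + 1) i) - ∑' i, durfeeTerm q (c + 2) i) := by
  have s := summable_durfeeTerm hq
  have e : ∀ c, ∑' i, durfeeTerm q c i = durfeeTerm q c 0 + ∑' i, durfeeTerm q c (i + 1) :=
    fun c => (s c).tsum_eq_zero_add
  have s' : ∀ c, Summable fun i => durfeeTerm q c (i + 1) :=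
    fun c => (summable_nat_add_iff 1).mpr (s c)
  have h : (∑' i, durfeeTerm q c (i + 1)) - ∑' i, durfeeTerm q (c + 1) (i + 1) =
      q ^ (c + 1) * (∑' i, durfeeTerm q (c + 2) i) -
        q ^ (c + 1) * ∑' i, durfeeTerm q (c + 1) (i + 1) := by
    rw [← (s' c).tsum_sub (s' (c + 1)), ← tsum_mul_left, ← tsum_mul_left,
      ← ((s (c + 2)).mul_left _).tsum_sub ((s' (c + 1)).mul_left _)]
    exact tsum_congr (durfeeTerm_succ_sub hq c)
  rw [e c, e (c + 1)]
  linear_combination h + durfeeTerm_zero_sub hq c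

/-- The factor q^{ic} kills every term with i > 0 as c grows; only 1/(q)_c survives. -/
lemma tendsto_tsum_durfeeTerm {q : ℂ} (hq : ‖q‖ < 1) :
    Tendsto (fun c => ∑' i, durfeeTerm q c i) atTop (𝓝 (qPochInf q q)⁻¹) := by
  obtain ⟨B, hB0, hB⟩ := exists_norm_inv_qPoch_self_le hq
  have key := tendsto_tsum_of_dominated_convergence (𝓕 := atTop)
    (f := fun c i => durfeeTerm q c i)
    (g := fun i => if i = 0 then (qPochInf q q)⁻¹ else 0)
    ((summable_geometric_of_lt_one (norm_nonneg q) hq).mul_left (B * B)) (fun i => ?_)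
    (Eventually.of_forall fun c i => norm_durfeeTerm_le hq hB0 hB c i)
  · simpa using key
  · rcases i with _ | i
    · simpa [durfeeTerm] using tendsto_inv_qPoch_self hq
    · have hp : Tendsto (fun c => q ^ ((i + 1) * (i + 1) + (i + 1) * c)) atTop (𝓝 0) := by
        refine (tendsto_pow_atTop_nhds_zero_of_norm_lt_one hq).comp
          (tendsto_atTop_mono (fun c => ?_) tendsto_id)
        simp only [id]
        nlinarith
      have hc : Tendsto (fun c => (qPoch q q (i + 1 + c))⁻¹) atTop (𝓝 (qPochInf q q)⁻¹) := by
        simpa only [add_comm] using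
          (tendsto_add_atTop_iff_nat (i + 1)).mpr (tendsto_inv_qPoch_self hq)
      simpa [durfeeTerm] using hp.mul (hc.const_mul (qPoch q q (i + 1))⁻¹)

/-- Cauchy's identity `∑ q^{i² + ic} / ((q)_i (q)_{i+c}) = 1 / (q)_∞`. -/
theorem hasSum_durfeeTerm {q : ℂ} (hq : ‖q‖ < 1) (c : ℕ) :
    HasSum (durfeeTerm q c) (qPochInf q q)⁻¹ := by
  set F : ℕ → ℂ := fun c => ∑' i, durfeeTerm q c i with hF
  have hlim : Tendsto F atTop (𝓝 (qPochInf q q)⁻¹) := tendsto_tsum_durfeeTerm hq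
  have hstep : ∀ c, ‖F c - F (c + 1)‖ ≤ ‖F (c + 1) - F (c + 2)‖ := fun c => by
    have h := tsum_durfeeTerm_sub hq c
    rw [show F c - F (c + 1) = _ from h, norm_mul, norm_neg, norm_pow]
    exact mul_le_of_le_one_left (norm_nonneg _) (pow_le_one₀ (norm_nonneg q) hq.le)
  -- The consecutive differences grow in norm yet tend to 0, so all vanish and F is constant, equal
  -- to its limit.
  have hmono : Monotone fun c => ‖F c - F (c + 1)‖ := monotone_nat_of_le_succ hstep
  have hzero : Tendsto (fun c => ‖F c - F (c + 1)‖) atTop (𝓝 0) := by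
    simpa using (hlim.sub ((tendsto_add_atTop_iff_nat 1).mpr hlim)).norm
  have hconst : ∀ c, F (c + 1) = F c := fun c =>
    (sub_eq_zero.mp (norm_le_zero_iff.mp (hmono.ge_of_tendsto hzero c))).symm
  have hall : ∀ c, F c = F 0 := fun c => by
    induction c with
    | zero => rfl
    | succ c ih => rw [hconst, ih]
  have hval : F c = (qPochInf q q)⁻¹ := by
    refine tendsto_nhds_unique ?_ hlim
    exact tendsto_const_nhds.congr fun d => (hall c).trans (hall d).symm
  exact hval ▸ (summable_durfeeTerm hq c).hasSum

/-! ### q-binomial coefficients and the sum over n -/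

lemma qBinom_natCast (q : ℂ) {n k : ℕ} (h : k ≤ n) :
    qBinom q n k = qPoch q q n / (qPoch q q k * qPoch q q (n - k)) := by
  rw [qBinom, if_pos ⟨by positivity, by exact_mod_cast h⟩, Int.toNat_natCast]

lemma qBinom_of_neg (q : ℂ) (n : ℕ) {k : ℤ} (h : k < 0) : qBinom q n k = 0 :=
  if_neg fun h' => by omega

lemma qBinom_of_lt (q : ℂ) (n : ℕ) {k : ℤ} (h : (n : ℤ) < k) : qBinom q n k = 0 :=
  if_neg fun h' => by omega

lemma qBinom_symm (q : ℂ) (n : ℕ) (k : ℤ) : qBinom q n (n - k) = qBinom q n k := by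
  by_cases h : 0 ≤ k ∧ k ≤ n
  · obtain ⟨k, rfl⟩ := Int.eq_ofNat_of_zero_le h.1
    have hk : k ≤ n := by exact_mod_cast h.2
    rw [← Nat.cast_sub hk, qBinom_natCast q hk,
      qBinom_natCast q (Nat.sub_le n k), Nat.sub_sub_self hk, mul_comm (qPoch q q k)]
  · rw [qBinom, qBinom, if_neg h, if_neg (by omega)]

lemma norm_qBinom_div_le {q : ℂ} (hq : ‖q‖ < 1) {B : ℝ} (hB0 : 0 ≤ B)
    (hB : ∀ n, ‖(qPoch q q n)⁻¹‖ ≤ B) (n : ℕ) (k : ℤ) :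
    ‖qBinom q n k / qPoch q q n‖ ≤ B * B := by
  rw [qBinom]
  split_ifs
  · rw [div_div_cancel_left' (qPoch_self_ne_zero hq n), mul_inv, norm_mul]
    exact mul_le_mul (hB _) (hB _) (norm_nonneg _) hB0
  · simpa using mul_nonneg hB0 hB0

/-- Terms with n < r vanish; n = i + r turns the rest into Cauchy's series with c = 2r + 1. -/
lemma hasSum_qBinom_nat {q : ℂ} (hq : ‖q‖ < 1) (r : ℕ) :
    HasSum (fun n : ℕ => q ^ (n * (n + 1)) / qPoch q q (2 * n + 1) * qBinom q (2 * n + 1) (n - r))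
      (q ^ (r * (r + 1)) * (qPochInf q q)⁻¹) := by
  rw [← (add_left_injective r).hasSum_iff]
  · refine ((hasSum_durfeeTerm hq (2 * r + 1)).mul_left (q ^ (r * (r + 1)))).congr_fun ?_
    intro i
    have h := qPoch_self_ne_zero hq (2 * (i + r) + 1)
    have e : ((i + r : ℕ) : ℤ) - r = (i : ℕ) := by push_cast; ring
    simp only [Function.comp_apply]
    rw [e, qBinom_natCast q (by omega),
      show 2 * (i + r) + 1 - i = i + (2 * r + 1) by omega, durfeeTerm]
    field_simp
    ring
  · intro n hn
    rw [qBinom_of_neg, mul_zero]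
    by_contra h
    exact hn ⟨n - r, Nat.sub_add_cancel (by omega)⟩

/-- The conjugate Bailey pair relation in the limit. -/
lemma hasSum_qBinom {q : ℂ} (hq : ‖q‖ < 1) (r : ℤ) :
    HasSum (fun n : ℕ => q ^ (n * (n + 1)) / qPoch q q (2 * n + 1) * qBinom q (2 * n + 1) (n - r))
      (q ^ (r * (r + 1)) * (qPochInf q q)⁻¹) := by
  -- Both sides are invariant under r ↦ -1 - r, by the symmetry of the q-binomial.
  obtain ⟨s, rfl | rfl⟩ : ∃ s : ℕ, r = s ∨ r = -(s + 1) := by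
    rcases le_or_gt 0 r with h | h
    · exact ⟨r.toNat, Or.inl (by omega)⟩
    · exact ⟨(-r - 1).toNat, Or.inr (by omega)⟩
  · exact_mod_cast hasSum_qBinom_nat hq s
  · have e : (-((s : ℤ) + 1)) * (-((s : ℤ) + 1) + 1) = ((s * (s + 1) : ℕ) : ℤ) := by
      push_cast; ring
    rw [e, zpow_natCast]
    refine (hasSum_qBinom_nat hq s).congr_fun fun n => ?_
    rw [← qBinom_symm q (2 * n + 1) (n - s)]
    congr 2
    push_cast; ring

/-! ### Triangular exponents and the bracket -/

lemma choose2_nonneg (x : ℤ) : 0 ≤ choose2 x := by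
  have h := two_mul_choose2 x
  rcases le_or_gt x 0 with h' | h' <;> nlinarith

lemma choose2_add_one (x : ℤ) : choose2 (x + 1) = choose2 x + x := by
  have h := two_mul_choose2 x
  have h' := two_mul_choose2 (x + 1)
  linarith

lemma choose2_one_sub (x : ℤ) : choose2 (1 - x) = choose2 x := by
  have h := two_mul_choose2 x
  have h' := two_mul_choose2 (1 - x)
  linarith

lemma choose2_natCast (n : ℕ) : choose2 n = (n.choose 2 : ℕ) := by
  induction n with
  | zero => rfl
  | succ n ih =>
    rw [Nat.cast_succ, choose2_add_one, ih, Nat.choose_succ_succ' n 1, Nat.choose_one_right]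
    push_cast; ring

lemma norm_zpow_le_one {q : ℂ} (hq : ‖q‖ < 1) {x : ℤ} (hx : 0 ≤ x) : ‖q ^ x‖ ≤ 1 := by
  lift x to ℕ using hx
  rw [zpow_natCast, norm_pow]
  exact pow_le_one₀ (norm_nonneg q) hq.le

/-- The `n`-th summand attached to the index `r` after absorbing the outer prefactor. -/
noncomputable def baileyTerm (q : ℂ) (n : ℕ) (r : ℤ) : ℂ :=
  q ^ (n * (n + 1)) / qPoch q q (2 * n + 1) * (q ^ choose2 (r + 1) *
    (qBinom q (2 * n + 1) (n - r) - q ^ (r + 1) * qBinom q (2 * n + 1) (n - r - 1)))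

/-- The sum over `n` of `baileyTerm`, up to the factor `1 / (q)_∞`. -/
noncomputable def baileySum (q : ℂ) (r : ℤ) : ℂ :=
  q ^ (3 * choose2 (r + 1)) - q ^ (3 * choose2 (r + 2))

/-- Absorbing q^{r+1} into the triangular power leaves only nonnegative exponents, which makes
bounds uniform in r possible. -/
lemma baileyTerm_eq {q : ℂ} (hq0 : q ≠ 0) (n : ℕ) (r : ℤ) :
    baileyTerm q n r = q ^ choose2 (r + 1) * (q ^ (n * (n + 1)) / qPoch q q (2 * n + 1) *
        qBinom q (2 * n + 1) (n - r)) -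
      q ^ choose2 (r + 2) * (q ^ (n * (n + 1)) / qPoch q q (2 * n + 1) *
        qBinom q (2 * n + 1) (n - (r + 1 : ℤ))) := by
  rw [show r + 2 = r + 1 + 1 by ring, choose2_add_one (r + 1), zpow_add₀ hq0, baileyTerm,
    sub_add_eq_sub_sub]
  ring

lemma hasSum_baileyTerm {q : ℂ} (hq0 : q ≠ 0) (hq : ‖q‖ < 1) (r : ℤ) :
    HasSum (fun n => baileyTerm q n r) (baileySum q r * (qPochInf q q)⁻¹) := by
  have h := ((hasSum_qBinom hq r).mul_left (q ^ choose2 (r + 1))).sub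
    ((hasSum_qBinom hq (r + 1)).mul_left (q ^ choose2 (r + 2)))
  have h1 := two_mul_choose2 (r + 1)
  have h2 := two_mul_choose2 (r + 2)
  have e1 : 3 * choose2 (r + 1) = choose2 (r + 1) + r * (r + 1) := by linarith
  have e2 : 3 * choose2 (r + 2) = choose2 (r + 2) + (r + 1) * (r + 1 + 1) := by linarith
  simp only [baileyTerm_eq hq0]
  rw [baileySum, e1, e2, zpow_add₀ hq0, zpow_add₀ hq0, sub_mul, mul_assoc, mul_assoc]
  exact h

lemma exists_norm_baileyTerm_le {q : ℂ} (hq0 : q ≠ 0) (hq : ‖q‖ < 1) :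
    ∃ C : ℝ, 0 ≤ C ∧ ∀ n r, ‖baileyTerm q n r‖ ≤ C * ‖q‖ ^ n := by
  obtain ⟨B, hB0, hB⟩ := exists_norm_inv_qPoch_self_le hq
  have aux : ∀ (n : ℕ) (x y : ℤ), 0 ≤ y →
      ‖q ^ y * (q ^ (n * (n + 1)) / qPoch q q (2 * n + 1) * qBinom q (2 * n + 1) x)‖ ≤
        B * B * ‖q‖ ^ n := fun n x y hy => by
    have e : q ^ y * (q ^ (n * (n + 1)) / qPoch q q (2 * n + 1) * qBinom q (2 * n + 1) x) =
        q ^ y * (qBinom q (2 * n + 1) x / qPoch q q (2 * n + 1) * q ^ (n * (n + 1))) := by ring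
    rw [e, norm_mul, norm_mul, norm_pow]
    refine (mul_le_of_le_one_left (by positivity) (norm_zpow_le_one hq hy)).trans ?_
    exact mul_le_mul (norm_qBinom_div_le hq hB0 hB _ _)
      (pow_le_pow_of_le_one (norm_nonneg q) hq.le (Nat.le_mul_of_pos_right n n.succ_pos))
      (by positivity) (by positivity)
  refine ⟨B * B + B * B, by positivity, fun n r => ?_⟩
  rw [baileyTerm_eq hq0, add_mul]
  exact (norm_sub_le _ _).trans
    (add_le_add (aux n _ _ (choose2_nonneg _)) (aux n _ _ (choose2_nonneg _)))

/-! ### The theta weight and interchange of sums -/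

lemma norm_neg_one_zpow (m : ℤ) : ‖(-1 : ℂ) ^ m‖ = 1 := by
  rw [norm_zpow, norm_neg, norm_one, one_zpow]

lemma summable_norm_thetaWeight {q : ℂ} (hq : ‖q‖ < 1) :
    Summable fun m : ℤ => ‖(-1 : ℂ) ^ m * q ^ choose2 (m + 1)‖ := by
  have key : ∀ j : ℕ, ‖q ^ choose2 (j + 1)‖ ≤ ‖q‖ ^ j := fun j => by
    have h : choose2 ((j : ℤ) + 1) = ((j + 1).choose 2 : ℕ) := by
      rw [← choose2_natCast]; push_cast; rfl
    rw [h, zpow_natCast, norm_pow]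
    refine pow_le_pow_of_le_one (norm_nonneg q) hq.le ?_
    rw [Nat.choose_succ_succ' j 1, Nat.choose_one_right]
    exact Nat.le_add_right _ _
  have hg := summable_geometric_of_lt_one (norm_nonneg q) hq
  simp only [norm_mul, norm_neg_one_zpow, one_mul]
  refine Summable.of_nat_of_neg_add_one
    (hg.of_nonneg_of_le (fun _ => norm_nonneg _) key)
    (hg.of_nonneg_of_le (fun _ => norm_nonneg _) fun j => ?_)
  rw [show -((j : ℤ) + 1) + 1 = 1 - (j + 1) by ring, choose2_one_sub]
  exact key j

/-- Interchange of the sum over `n` and a weighted sum over an auxiliary index. -/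
lemma hasSum_tsum_mul_of_geometric_bound {ι : Type*} {w : ι → ℂ} (hw : Summable fun i => ‖w i‖)
    {ρ C : ℝ} (hC : 0 ≤ C) (hρ0 : 0 ≤ ρ) (hρ : ρ < 1) {g : ℕ → ι → ℂ} (hg : ∀ n i, ‖g n i‖ ≤ C * ρ ^ n)
    {f : ι → ℂ} (hf : ∀ i, HasSum (fun n => g n i) (f i)) :
    (∀ n, Summable fun i => w i * g n i) ∧ (Summable fun i => w i * f i) ∧
      HasSum (fun n => ∑' i, w i * g n i) (∑' i, w i * f i) := by
  have hs : Summable fun p : ℕ × ι => w p.2 * g p.1 p.2 := by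
    have hb : Summable fun p : ℕ × ι => (C * ρ ^ p.1) * ‖w p.2‖ :=
      ((summable_geometric_of_lt_one hρ0 hρ).mul_left C).mul_of_nonneg hw
        (fun n => ?_) (fun i => norm_nonneg _)
    · refine .of_norm_bounded hb fun p => ?_
      rw [norm_mul, mul_comm]
      exact mul_le_mul_of_nonneg_right (hg _ _) (norm_nonneg _)
    · exact mul_nonneg hC (pow_nonneg hρ0 n)
  have hn : ∀ n, Summable fun i => w i * g n i := fun n => hs.prod_factor n
  have hi : ∀ i, HasSum (fun n => w i * g n i) (w i * f i) := fun i => (hf i).mul_left _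
  have hswap : HasSum (fun p : ι × ℕ => w p.1 * g p.2 p.1)
      (∑' p : ℕ × ι, w p.2 * g p.1 p.2) :=
    (Equiv.prodComm ι ℕ).hasSum_iff.mpr hs.hasSum
  have hsum := hswap.prod_fiberwise hi
  refine ⟨hn, hsum.summable, ?_⟩
  rw [hsum.tsum_eq]
  exact hs.hasSum.prod_fiberwise fun n => (hn n).hasSum

/-! ### The finite q-binomial theorem and the k-sum -/

lemma qBinom_zero_right {q : ℂ} (hq : ‖q‖ < 1) (n : ℕ) : qBinom q n (0 : ℕ) = 1 := by
  rw [qBinom_natCast q n.zero_le, qPoch_zero, one_mul, Nat.sub_zero,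
    div_self (qPoch_self_ne_zero hq n)]

lemma qBinom_self {q : ℂ} (hq : ‖q‖ < 1) (n : ℕ) : qBinom q n n = 1 := by
  rw [qBinom_natCast q le_rfl, Nat.sub_self, qPoch_zero, mul_one,
    div_self (qPoch_self_ne_zero hq n)]

lemma qBinom_succ_succ {q : ℂ} (hq : ‖q‖ < 1) {n k : ℕ} (h : k ≤ n) :
    qBinom q (n + 1) (k + 1 : ℕ) = qBinom q n (k + 1 : ℕ) + q ^ (n - k) * qBinom q n k := by
  obtain ⟨d, rfl⟩ := Nat.exists_eq_add_of_le h
  rcases d with _ | d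
  · simp only [Nat.add_zero]
    rw [qBinom_self hq, qBinom_self hq, qBinom_of_lt q k (by push_cast; omega)]
    simp
  · have h1 := qPoch_self_ne_zero hq k
    have h2 := qPoch_self_ne_zero hq d
    have h3 := one_sub_pow_succ_ne_zero hq k
    have h4 := one_sub_pow_succ_ne_zero hq d
    rw [qBinom_natCast q (by omega), qBinom_natCast q (by omega), qBinom_natCast q (by omega),
      show k + (d + 1) + 1 - (k + 1) = d + 1 by omega, show k + (d + 1) - (k + 1) = d by omega,
      show k + (d + 1) - k = d + 1 by omega, qPoch_self_succ q (k + (d + 1)),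
      qPoch_self_succ q k, qPoch_self_succ q d]
    field_simp
    ring

/-- The finite `q`-binomial theorem. -/
theorem sum_qBinom_eq_qPoch {q : ℂ} (hq : ‖q‖ < 1) (z : ℂ) (n : ℕ) :
    ∑ k ∈ Finset.range (n + 1), (-1) ^ k * q ^ k.choose 2 * qBinom q n k * z ^ k =
      qPoch z q n := by
  induction n with
  | zero =>
    have h := qBinom_self hq 0
    simp only [Nat.cast_zero] at h
    simp [h]
  | succ n ih =>
    have hsplit : ∀ k ∈ Finset.range (n + 1),
        (-1) ^ (k + 1) * q ^ (k + 1).choose 2 * qBinom q (n + 1) (k + 1 : ℕ) * z ^ (k + 1) =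
          (-1) ^ (k + 1) * q ^ (k + 1).choose 2 * qBinom q n (k + 1 : ℕ) * z ^ (k + 1) -
            z * q ^ n * ((-1) ^ k * q ^ k.choose 2 * qBinom q n k * z ^ k) := fun k hk => by
      have hk' : k ≤ n := Nat.lt_succ_iff.mp (Finset.mem_range.mp hk)
      have hp : q ^ n = q ^ k * q ^ (n - k) := by rw [← pow_add, Nat.add_sub_cancel' hk']
      rw [qBinom_succ_succ hq hk', Nat.choose_succ_succ' k 1, Nat.choose_one_right, hp]
      ring
    -- The extra term k = n + 1 is zero, so the sum over shifted indices is known from `ih` minus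
    -- its k = 0 term.
    have htop := Finset.sum_range_succ
      (fun k : ℕ => (-1) ^ k * q ^ k.choose 2 * qBinom q n k * z ^ k) (n + 1)
    rw [Finset.sum_range_succ', ih, qBinom_of_lt q n (k := (n + 1 : ℕ)) (by push_cast; omega),
      qBinom_zero_right hq] at htop
    rw [Finset.sum_range_succ', Finset.sum_congr rfl hsplit, Finset.sum_sub_distrib,
      ← Finset.mul_sum, ih, qPoch_succ, qBinom_zero_right hq]
    linear_combination htop

lemma choose2_sub_add_one (s : ℤ) (k : ℕ) :
    choose2 (s - k + 1) = choose2 (s + 1) + (k.choose 2 : ℕ) - s * k := by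
  rw [← choose2_natCast]
  have h1 := two_mul_choose2 (s - k + 1)
  have h2 := two_mul_choose2 (s + 1)
  have h3 := two_mul_choose2 k
  linarith

/-- The coefficient obtained by summing over `k` with `m + k = s` fixed. -/
lemma sum_thetaWeight_mul_qBinom {q : ℂ} (hq0 : q ≠ 0) (hq : ‖q‖ < 1) (ℓ : ℕ) (s : ℤ) :
    ∑ k ∈ Finset.range (ℓ + 1),
        (-1 : ℂ) ^ (s - k) * q ^ choose2 (s - k + 1) * qBinom q ℓ k =
      (-1) ^ s * q ^ choose2 (s + 1) * qPoch (q ^ (-s)) q ℓ := by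
  rw [← sum_qBinom_eq_qPoch hq, Finset.mul_sum]
  refine Finset.sum_congr rfl fun k _ => ?_
  have h1 : (-1 : ℂ) ^ (s - k) = (-1) ^ s * (-1) ^ k := by
    rw [zpow_sub₀ (by norm_num), zpow_natCast, div_eq_mul_inv, ← inv_pow]
    norm_num
  have h2 : q ^ choose2 (s - k + 1) = q ^ choose2 (s + 1) * q ^ k.choose 2 * (q ^ (-s)) ^ k := by
    rw [choose2_sub_add_one, sub_eq_add_neg, zpow_add₀ hq0, zpow_add₀ hq0, zpow_natCast,
      ← neg_mul, zpow_mul, zpow_natCast]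
  rw [h1, h2]
  ring

lemma qPoch_zpow_neg_eq_zero {q : ℂ} (hq0 : q ≠ 0) {s ℓ : ℕ} (h : s < ℓ) :
    qPoch (q ^ (-(s : ℤ))) q ℓ = 0 := by
  refine Finset.prod_eq_zero (Finset.mem_range.mpr h) ?_
  rw [zpow_neg, zpow_natCast, inv_mul_cancel₀ (pow_ne_zero s hq0), sub_self]

/-- Each factor is 1 - q^{-i} = -q^{-i}(1 - q^i) with j < i ≤ j + ℓ; the extracted signs and powers
account for the change of weight. -/
lemma thetaWeight_mul_qPoch_zpow_neg {q : ℂ} (hq0 : q ≠ 0) (ℓ j : ℕ) :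
    (-1 : ℂ) ^ (j + ℓ) * q ^ (j + ℓ + 1).choose 2 * qPoch (q ^ (-((j + ℓ : ℕ) : ℤ))) q ℓ =
      (-1) ^ j * q ^ (j + 1).choose 2 * qPoch (q ^ (j + 1)) q ℓ := by
  induction ℓ with
  | zero => simp
  | succ ℓ ih =>
    have h : qPoch (q ^ (-((j + (ℓ + 1) : ℕ) : ℤ))) q (ℓ + 1) =
        qPoch (q ^ (-((j + ℓ : ℕ) : ℤ))) q ℓ * (1 - (q ^ (j + ℓ + 1))⁻¹) := by
      rw [qPoch, Finset.prod_range_succ', qPoch]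
      congr 1
      · refine Finset.prod_congr rfl fun i _ => ?_
        have e : -((j + ℓ : ℕ) : ℤ) = -((j + (ℓ + 1) : ℕ) : ℤ) + 1 := by push_cast; ring
        rw [e, zpow_add_one₀ hq0]
        ring
      · rw [pow_zero, mul_one, zpow_neg, zpow_natCast, add_assoc]
    have hne : q ^ (j + ℓ + 1) ≠ 0 := pow_ne_zero _ hq0
    have hinv : q ^ (j + ℓ + 1) * (1 - (q ^ (j + ℓ + 1))⁻¹) = -(1 - q ^ (j + ℓ + 1)) := by
      rw [mul_sub, mul_inv_cancel₀ hne]; ring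
    rw [h, qPoch_succ, ← add_assoc, Nat.choose_succ_succ' (j + ℓ + 1) 1, Nat.choose_one_right,
      pow_add q (j + ℓ + 1), pow_succ]
    have hp : q ^ (j + 1) * q ^ ℓ = q ^ (j + ℓ + 1) := by ring
    rw [hp]
    linear_combination (1 - q ^ (j + ℓ + 1)) * ih +
      (-((-1 : ℂ) ^ (j + ℓ) * q ^ (j + ℓ + 1).choose 2 *
        qPoch (q ^ (-((j + ℓ : ℕ) : ℤ))) q ℓ)) * hinv

/-! ### Folding the bilateral series -/

lemma baileySum_neg_two_sub (q : ℂ) (r : ℤ) : baileySum q (-2 - r) = -baileySum q r := by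
  rw [baileySum, baileySum, show -2 - r + 1 = 1 - (r + 2) by ring,
    show -2 - r + 2 = 1 - (r + 1) by ring, choose2_one_sub, choose2_one_sub, neg_sub]

lemma norm_baileySum_le {q : ℂ} (hq : ‖q‖ < 1) (r : ℤ) : ‖baileySum q r‖ ≤ 2 := by
  refine (norm_sub_le _ _).trans ((add_le_add (norm_zpow_le_one hq ?_)
    (norm_zpow_le_one hq ?_)).trans_eq one_add_one_eq_two) <;>
  exact mul_nonneg (by norm_num) (choose2_nonneg _)

/-- The terms of the bilateral series after the `k`-sum is evaluated. -/
noncomputable def bilateralTerm (q : ℂ) (ℓ : ℕ) (s : ℤ) : ℂ :=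
  (-1) ^ s * q ^ choose2 (s + 1) * qPoch (q ^ (-s)) q ℓ * baileySum q (2 * s - ℓ)

lemma rightTerm_eq (q : ℂ) (ℓ j : ℕ) :
    rightTerm q ℓ j = (-1) ^ j * q ^ (j + 1).choose 2 * qPoch (q ^ (j + 1)) q ℓ *
      baileySum q (2 * j + ℓ) := by
  have e1 : choose2 (2 * j + ℓ + 1) = ((2 * j + ℓ + 1).choose 2 : ℕ) := by
    rw [← choose2_natCast]; push_cast; rfl
  have e2 : choose2 (2 * j + ℓ + 2) = choose2 (2 * j + ℓ + 1) + (2 * j + ℓ + 1) := by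
    rw [← choose2_add_one]; ring_nf
  have e3 : 3 * choose2 (2 * j + ℓ + 1) = (3 * (2 * j + ℓ + 1).choose 2 : ℕ) := by
    rw [e1]; push_cast; ring
  have e4 : 3 * choose2 (2 * j + ℓ + 2) =
      (3 * (2 * j + ℓ + 1).choose 2 + (6 * j + 3 * ℓ + 3) : ℕ) := by
    rw [e2, e1]; push_cast; ring
  rw [baileySum, e3, e4, zpow_natCast, zpow_natCast, rightTerm]
  ring

lemma bilateralTerm_of_lt {q : ℂ} (hq0 : q ≠ 0) {ℓ s : ℕ} (h : s < ℓ) :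
    bilateralTerm q ℓ s = 0 := by
  rw [bilateralTerm, qPoch_zpow_neg_eq_zero hq0 h, mul_zero, zero_mul]

lemma bilateralTerm_add {q : ℂ} (hq0 : q ≠ 0) (ℓ j : ℕ) :
    bilateralTerm q ℓ (j + ℓ : ℕ) = rightTerm q ℓ j := by
  have e : choose2 (((j + ℓ : ℕ) : ℤ) + 1) = ((j + ℓ + 1).choose 2 : ℕ) := by
    rw [← choose2_natCast]; push_cast; rfl
  rw [bilateralTerm, rightTerm_eq, ← thetaWeight_mul_qPoch_zpow_neg hq0, e, zpow_natCast,
    zpow_natCast]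
  congr 2
  push_cast; ring

/-- The sign from (-1)^{-(j+1)} cancels the one from the antisymmetry of `baileySum` under r ↦ -2 -
r. -/
lemma bilateralTerm_neg_add_one (q : ℂ) (ℓ j : ℕ) :
    bilateralTerm q ℓ (-((j : ℤ) + 1)) = rightTerm q ℓ j := by
  have e : choose2 (-((j : ℤ) + 1) + 1) = ((j + 1).choose 2 : ℕ) := by
    rw [← choose2_natCast, show -((j : ℤ) + 1) + 1 = 1 - (j + 1) by ring, choose2_one_sub]
    push_cast; rfl
  have e1 : (-1 : ℂ) ^ (-((j : ℤ) + 1)) = -(-1) ^ j := by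
    rw [zpow_neg, ← Nat.cast_succ, zpow_natCast, ← inv_pow, pow_succ]
    norm_num
  have e2 : q ^ (- -((j : ℤ) + 1)) = q ^ (j + 1) := by
    rw [neg_neg]; norm_cast
  rw [bilateralTerm, rightTerm_eq, e, e1, e2, zpow_natCast,
    show 2 * -((j : ℤ) + 1) - ℓ = -2 - (2 * j + ℓ) by ring, baileySum_neg_two_sub]
  ring

lemma tsum_bilateralTerm {q : ℂ} (hq0 : q ≠ 0) (ℓ : ℕ) (h : Summable (bilateralTerm q ℓ)) :
    Summable (rightTerm q ℓ) ∧ ∑' s, bilateralTerm q ℓ s = 2 * ∑' j, rightTerm q ℓ j := by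
  have hr : Summable (rightTerm q ℓ) := by
    refine (h.comp_injective (i := fun j : ℕ => ((j + ℓ : ℕ) : ℤ)) fun a b hab => ?_).congr
      fun j => bilateralTerm_add hq0 ℓ j
    simpa using hab
  refine ⟨hr, ?_⟩
  have hpos : HasSum (fun s : ℕ => bilateralTerm q ℓ s) (∑' j, rightTerm q ℓ j) := by
    rw [← (add_left_injective ℓ).hasSum_iff]
    · exact hr.hasSum.congr_fun fun j => bilateralTerm_add hq0 ℓ j
    · intro s hs
      refine bilateralTerm_of_lt hq0 ?_
      by_contra hs'
      exact hs ⟨s - ℓ, Nat.sub_add_cancel (by omega)⟩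
  have hneg : HasSum (fun j : ℕ => bilateralTerm q ℓ (-((j : ℤ) + 1))) (∑' j, rightTerm q ℓ j) :=
    hr.hasSum.congr_fun fun j => bilateralTerm_neg_add_one q ℓ j
  rw [(hpos.of_nat_of_neg_add_one hneg).tsum_eq, two_mul]

/-- Evaluation of the double sum over `m` and `k` by collecting the terms with `m + k = s`. -/
lemma hasSum_bilateralTerm {q : ℂ} (hq0 : q ≠ 0) (hq : ‖q‖ < 1) (ℓ : ℕ) :
    Summable (bilateralTerm q ℓ) ∧
      HasSum (fun m : ℤ => (-1 : ℂ) ^ m * q ^ choose2 (m + 1) *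
        ∑ k ∈ Finset.range (ℓ + 1), qBinom q ℓ k * baileySum q (2 * m + 2 * k - ℓ))
        (∑' s, bilateralTerm q ℓ s) := by
  set T : ℕ → ℤ → ℂ := fun k m =>
    (-1 : ℂ) ^ m * q ^ choose2 (m + 1) * (qBinom q ℓ k * baileySum q (2 * m + 2 * k - ℓ)) with hT
  have hs : ∀ k, Summable (T k) := fun k => by
    refine .of_norm_bounded ((summable_norm_thetaWeight hq).mul_right (‖qBinom q ℓ k‖ * 2))
      fun m => ?_
    rw [hT]
    simp only
    rw [norm_mul, norm_mul (qBinom q ℓ k)]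
    gcongr
    exact norm_baileySum_le hq _
  -- Summability for each k separately allows the shift m = s - k.
  have hshift : ∀ k : ℕ, HasSum (fun s : ℤ => T k (s - k)) (∑' m, T k m) := fun k =>
    (Equiv.subRight (k : ℤ)).hasSum_iff.mpr (hs k).hasSum
  have hcollect : HasSum (bilateralTerm q ℓ) (∑ k ∈ Finset.range (ℓ + 1), ∑' m, T k m) := by
    refine (hasSum_sum fun k _ => hshift k).congr_fun fun s => ?_
    rw [bilateralTerm, ← sum_thetaWeight_mul_qBinom hq0 hq, Finset.sum_mul]
    refine Finset.sum_congr rfl fun k _ => ?_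
    rw [hT]
    simp only
    rw [show 2 * (s - k) + 2 * (k : ℤ) - ℓ = 2 * s - ℓ by ring]
    ring
  refine ⟨hcollect.summable, ?_⟩
  rw [hcollect.tsum_eq]
  refine (hasSum_sum fun k (_ : k ∈ Finset.range (ℓ + 1)) => (hs k).hasSum).congr_fun fun m => ?_
  rw [Finset.mul_sum]

/-! ### Finite support and assembly -/

lemma finite_support_innerTerm (q : ℂ) (ℓ n : ℕ) :
    (Function.support fun m : ℤ => innerTerm q ℓ n m).Finite := by
  -- A crude window: outside it both lower indices leave [0, 2n+1] for every 0 ≤ k ≤ ℓ.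
  refine (Set.finite_Icc (-(n + ℓ + 2) : ℤ) (n + ℓ)).subset fun m hm => ?_
  by_contra hout
  refine hm (Finset.sum_eq_zero fun k hk => ?_)
  have hk' : k ≤ ℓ := Nat.lt_succ_iff.mp (Finset.mem_range.mp hk)
  rw [Set.mem_Icc, not_and_or, not_le, not_le] at hout
  rcases hout with h | h
  · rw [qBinom_of_lt q (2 * n + 1) (by push_cast; omega),
      qBinom_of_lt q (2 * n + 1) (by push_cast; omega)]
    ring
  · rw [qBinom_of_neg q (2 * n + 1) (by omega), qBinom_of_neg q (2 * n + 1) (by omega)]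
    ring

lemma prefactor_mul_innerTerm {q : ℂ} (hq0 : q ≠ 0) (ℓ n : ℕ) (m : ℤ) :
    q ^ (n * (n + 1)) / qPoch q q (2 * n + 1) * innerTerm q ℓ n m =
      (-1 : ℂ) ^ m * q ^ choose2 (m + 1) *
        ∑ k ∈ Finset.range (ℓ + 1), qBinom q ℓ k * baileyTerm q n (2 * m + 2 * k - ℓ) := by
  rw [innerTerm, Finset.mul_sum, Finset.mul_sum]
  refine Finset.sum_congr rfl fun k _ => ?_
  rw [baileyTerm, zpow_add₀ hq0 (choose2 _) (choose2 _),
    show (n : ℤ) - (2 * m + 2 * k - ℓ) = n - 2 * m - 2 * k + ℓ by ring]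
  ring

end QSeries

open QSeries in
theorem mainTheorem6 (q : ℂ) (hq0 : q ≠ 0) (hq : ‖q‖ < 1) (ℓ : ℕ) :
    (∀ n : ℕ, (Function.support fun m : ℤ => QSeries.innerTerm q ℓ n m).Finite) ∧
    Summable (fun j : ℕ => QSeries.rightTerm q ℓ j) ∧
    HasSum
      (fun n : ℕ => q ^ (n * (n + 1)) / QSeries.qPoch q q (2 * n + 1) *
        ∑' m : ℤ, QSeries.innerTerm q ℓ n m)
      (2 / QSeries.qPochInf q q * ∑' j : ℕ, QSeries.rightTerm q ℓ j) := by
  obtain ⟨hsum, hbil⟩ := hasSum_bilateralTerm hq0 hq ℓ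
  obtain ⟨hright, htwo⟩ := tsum_bilateralTerm hq0 ℓ hsum
  obtain ⟨C, hC0, hC⟩ := exists_norm_baileyTerm_le hq0 hq
  refine ⟨finite_support_innerTerm q ℓ, hright, ?_⟩
  have hbound : ∀ (n : ℕ) (m : ℤ),
      ‖∑ k ∈ Finset.range (ℓ + 1), qBinom q ℓ k * baileyTerm q n (2 * m + 2 * k - ℓ)‖ ≤
        (∑ k ∈ Finset.range (ℓ + 1), ‖qBinom q ℓ k‖ * C) * ‖q‖ ^ n := fun n m => by
    rw [Finset.sum_mul]
    refine norm_sum_le_of_le _ fun k _ => ?_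
    rw [norm_mul, mul_assoc]
    exact mul_le_mul_of_nonneg_left (hC _ _) (norm_nonneg _)
  have hmain := (hasSum_tsum_mul_of_geometric_bound (summable_norm_thetaWeight hq)
    (Finset.sum_nonneg fun k _ => mul_nonneg (norm_nonneg _) hC0) (norm_nonneg q) hq hbound
    fun m => hasSum_sum fun k _ =>
      (hasSum_baileyTerm hq0 hq (2 * m + 2 * k - ℓ)).mul_left (qBinom q ℓ k)).2.2
  have hval := hbil.mul_right (qPochInf q q)⁻¹
  rw [htwo] at hval
  have hv : 2 / qPochInf q q * ∑' j, rightTerm q ℓ j =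
      2 * (∑' j, rightTerm q ℓ j) * (qPochInf q q)⁻¹ := by ring
  rw [hv, ← hval.tsum_eq]
  simp only [← tsum_mul_left, prefactor_mul_innerTerm hq0]
  simpa only [mul_assoc, Finset.sum_mul] using hmain
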